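/- **Conventions.** A residuated lattice is an algebra $(A,\vee,\wedge,\odot,\to,0,1)$ such that $(A,\vee,\wedge,0,1)$ is a bounded lattice, $(A,\odot,1)$ is a commutative monoid, and $a\le b\to c$ iff $a\odot b\le c$ for all $a,b,c\in A$. For a bounded lattice $L$, $\mathcal B(L)$ denotes the set of its complemented elements. A *filter* of $A$ is a non-empty subset that is closed under $\odot$ and upward closed. $\mathrm{Filt}(A)$ is the lattice of all filters of $A$ ordered by inclusion, $\mathrm{PFilt}(A)$ is its bounded sublattice consisting of the principal filters $[x)$, $x\in A$ (the filters generated by one element), and $\mathrm{Con}(A)$ is the lattice of congruences of $A$ ordered by inclusion. For a filter $F$, $A/F$ is the quotient of $A$ by the congruence $x\sim_F y$ iff $(x\to y)\wedge(y\to x)\in F$. * $A$ has *CBLP* if for every $\theta\in\mathrm{Con}(A)$ the map $\mathrm{Con}(A)\to\mathrm{Con}(A/\theta)$, $\alpha\mapsto(\alpha\vee\theta)/\theta$, sends $\mathcal B(\mathrm{Con}(A))$ onto $\mathcal B(\mathrm{Con}(A/\theta))$. * $A$ has *BLP* if for every filter $F$ of $A$ the canonical surjection $A\to A/F$ sends $\mathcal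 B(A)$ onto $\mathcal B(A/F)$. * A bounded lattice $L$ is *B-normal* if for all $x,y\in L$ with $x\vee y=1$ there are $e,f\in\mathcal B(L)$ with $e\wedge f=0$ and $x\vee e=y\vee f=1$; it is *B-conormal* if its dual is B-normal. * A bounded distributive lattice $L$ has *Filt-BLP* if $\mathcal B(L/F)=\mathcal B(L)/F$ for every lattice filter $F$ of $L$, where $L/F$ is the quotient by the congruence: $x\equiv y$ iff $x\wedge a=y\wedge a$ for some $a\in F$. It has *Id-BLP* if $\mathcal B(L/I)=\mathcal B(L)/I$ for every ideal $I$ of $L$, where $L/I$ is the quotient by the congruence: $x\approx y$ iff $x\vee a=y\vee a$ for some $a\in I$. * A *prime filter* is a proper filter $P$ such that $x\vee y\in P$ implies $x\in P$ or $y\in P$. The *Stone topology* on the set of prime filters (of $A$, or of a bounded distributive lattice) has the basis of the sets $\{P: a\notin P\}$. The *reticulation* $\mathcal L(A)$ of $A$ is the bounded distributive lattice, unique up to isomorphism, whose space of prime filters is homeomorphic to the space of prime filters of $A$. The quotient of $A$ that identifies two elements iff they belong to the same prime filters, ordered by inclusion of the sets of prime filters that contain them, is such a lattice. **Proposition.**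 Let $A$ be a residuated lattice and let $\mathcal L(A)$ be its reticulation (that is, any bounded distributive lattice with the property above). Then the following are equivalent: 1. $A$ has CBLP; 2. $A$ has BLP; 3. $\mathrm{Con}(A)$ is a B-normal lattice; 4. $\mathrm{Filt}(A)$ is a B-normal lattice; 5. $\mathrm{PFilt}(A)$ is a B-normal lattice; 6. $\mathcal L(A)$ is a B-conormal lattice; 7. $\mathcal L(A)$ has Filt-BLP; 8. $\mathrm{PFilt}(A)$ has Id-BLP. -/

import Mathlib

universe u v

namespace ResLat

/-! ### Bounded lattices: Boolean center, B-normality, quotients, lifting properties -/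

/-- The Boolean center of a bounded lattice: the set of its complemented elements. -/
def boolCenter (L : Type u) [Lattice L] [BoundedOrder L] : Set L :=
  {x | IsComplemented x}

/-- `L` is B-normal: whenever `x ⊔ y = 1` there are complemented `e`, `f` with `e ⊓ f = 0` and
`x ⊔ e = y ⊔ f = 1`. -/
def BNormal (L : Type u) [Lattice L] [BoundedOrder L] : Prop :=
  ∀ x y : L, x ⊔ y = ⊤ →
    ∃ e ∈ boolCenter L, ∃ f ∈ boolCenter L, e ⊓ f = ⊥ ∧ x ⊔ e = ⊤ ∧ y ⊔ f = ⊤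

/-- `L` is B-conormal: its order dual is B-normal. -/
def BConormal (L : Type u) [Lattice L] [BoundedOrder L] : Prop :=
  BNormal Lᵒᵈ

section LatticeQuotient

variable {L : Type u} [Lattice L]

/-- The quotient of a lattice by a lattice congruence. -/
def LatQuot (c : LatticeCon L) : Type u := Quotient c.toSetoid

/-- The canonical surjection. -/
def LatQuot.mk (c : LatticeCon L) (x : L) : LatQuot c := Quotient.mk c.toSetoid x

theorem LatQuot.ind {c : LatticeCon L} {p : LatQuot c → Prop} (h : ∀ x, p (LatQuot.mk c x))
    (q : LatQuot c) : p q := Quotient.ind h q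

theorem LatQuot.mk_eq_iff (c : LatticeCon L) {x y : L} :
    LatQuot.mk c x = LatQuot.mk c y ↔ c.r x y := by
  constructor
  · intro h
    exact Quotient.exact (s := c.toSetoid) h
  · intro h
    exact Quotient.sound (s := c.toSetoid) h

/-- The join induced on the quotient. -/
@[reducible] def LatQuot.quotMax (c : LatticeCon L) : Max (LatQuot c) where
  max := Quotient.map₂ (· ⊔ ·) (fun _ _ h₁ _ _ h₂ => c.sup h₁ h₂)

/-- The meet induced on the quotient. -/
@[reducible] def LatQuot.quotMin (c : LatticeCon L) : Min (LatQuot c) where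
  min := Quotient.map₂ (· ⊓ ·) (fun _ _ h₁ _ _ h₂ => c.inf h₁ h₂)

/-- The quotient lattice, with the operations induced from `L`. -/
instance (c : LatticeCon L) : Lattice (LatQuot c) :=
  letI := LatQuot.quotMax c
  letI := LatQuot.quotMin c
  have hs (x y : L) : LatQuot.mk c (x ⊔ y) = LatQuot.mk c x ⊔ LatQuot.mk c y := rfl
  have hi (x y : L) : LatQuot.mk c (x ⊓ y) = LatQuot.mk c x ⊓ LatQuot.mk c y := rfl
  Lattice.mk'
    (by
      intro a b
      induction a using LatQuot.ind with | _ a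
      induction b using LatQuot.ind with | _ b
      rw [← hs, ← hs, sup_comm])
    (by
      intro a b d
      induction a using LatQuot.ind with | _ a
      induction b using LatQuot.ind with | _ b
      induction d using LatQuot.ind with | _ d
      simp only [← hs, sup_assoc])
    (by
      intro a b
      induction a using LatQuot.ind with | _ a
      induction b using LatQuot.ind with | _ b
      rw [← hi, ← hi, inf_comm])
    (by
      intro a b d
      induction a using LatQuot.ind with | _ a
      induction b using LatQuot.ind with | _ b
      induction d using LatQuot.ind with | _ d
      simp only [← hi, inf_assoc])
    (by
      intro a b
      induction a using LatQuot.ind with | _ a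
      induction b using LatQuot.ind with | _ b
      rw [← hi, ← hs, sup_inf_self])
    (by
      intro a b
      induction a using LatQuot.ind with | _ a
      induction b using LatQuot.ind with | _ b
      rw [← hs, ← hi, inf_sup_self])

theorem LatQuot.mk_sup (c : LatticeCon L) (x y : L) :
    LatQuot.mk c (x ⊔ y) = LatQuot.mk c x ⊔ LatQuot.mk c y := rfl

theorem LatQuot.mk_inf (c : LatticeCon L) (x y : L) :
    LatQuot.mk c (x ⊓ y) = LatQuot.mk c x ⊓ LatQuot.mk c y := rfl

theorem LatQuot.mk_le_mk_iff (c : LatticeCon L) {x y : L} :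
    LatQuot.mk c x ≤ LatQuot.mk c y ↔ c.r (x ⊓ y) x := by
  rw [← inf_eq_left, ← LatQuot.mk_inf, LatQuot.mk_eq_iff]

theorem LatQuot.mk_mono (c : LatticeCon L) {x y : L} (h : x ≤ y) :
    LatQuot.mk c x ≤ LatQuot.mk c y := by
  rw [LatQuot.mk_le_mk_iff, inf_eq_left.2 h]

instance [BoundedOrder L] (c : LatticeCon L) : BoundedOrder (LatQuot c) where
  top := LatQuot.mk c ⊤
  bot := LatQuot.mk c ⊥
  le_top := LatQuot.ind fun _ => LatQuot.mk_mono c le_top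
  bot_le := LatQuot.ind fun _ => LatQuot.mk_mono c bot_le

/-- A lattice congruence `c` has the Boolean Lifting Property iff `B(L/c) = B(L)/c`. -/
def LatConHasBLP [BoundedOrder L] (c : LatticeCon L) : Prop :=
  boolCenter (LatQuot c) = LatQuot.mk c '' boolCenter L

end LatticeQuotient

section DistribLattice

variable {L : Type u} [DistribLattice L]

/-- The congruence of a filter `F`: `x ≡ y` iff `x ⊓ a = y ⊓ a` for some `a ∈ F`. -/
def filterCon (F : Order.PFilter L) : LatticeCon L where
  r x y := ∃ a ∈ F, x ⊓ a = y ⊓ a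
  iseqv :=
    { refl := fun x => ⟨_, F.nonempty.some_mem, rfl⟩
      symm := fun ⟨a, ha, h⟩ => ⟨a, ha, h.symm⟩
      trans := by
        rintro x y z ⟨a, ha, h⟩ ⟨b, hb, k⟩
        refine ⟨a ⊓ b, Order.PFilter.inf_mem ha hb, ?_⟩
        rw [← inf_assoc, h, inf_right_comm, k, inf_right_comm, inf_assoc] }
  inf := by
    rintro w x y z ⟨a, ha, h⟩ ⟨b, hb, k⟩
    refine ⟨a ⊓ b, Order.PFilter.inf_mem ha hb, ?_⟩
    rw [inf_inf_inf_comm, h, k, inf_inf_inf_comm]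
  sup := by
    rintro w x y z ⟨a, ha, h⟩ ⟨b, hb, k⟩
    refine ⟨a ⊓ b, Order.PFilter.inf_mem ha hb, ?_⟩
    rw [inf_sup_right, inf_sup_right, ← inf_assoc, h, inf_left_comm, k, inf_left_comm,
      inf_assoc]

/-- The congruence of an ideal `I`: `x ≈ y` iff `x ⊔ a = y ⊔ a` for some `a ∈ I`. -/
def idealCon (I : Order.Ideal L) : LatticeCon L where
  r x y := ∃ a ∈ I, x ⊔ a = y ⊔ a
  iseqv :=
    { refl := fun x => ⟨_, I.nonempty.some_mem, rfl⟩
      symm := fun ⟨a, ha, h⟩ => ⟨a, ha, h.symm⟩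
      trans := by
        rintro x y z ⟨a, ha, h⟩ ⟨b, hb, k⟩
        refine ⟨a ⊔ b, Order.Ideal.sup_mem ha hb, ?_⟩
        rw [← sup_assoc, h, sup_right_comm, k, sup_right_comm, sup_assoc] }
  inf := by
    rintro w x y z ⟨a, ha, h⟩ ⟨b, hb, k⟩
    refine ⟨a ⊔ b, Order.Ideal.sup_mem ha hb, ?_⟩
    rw [sup_inf_right, sup_inf_right, ← sup_assoc, h, sup_left_comm, k, sup_left_comm,
      sup_assoc]
  sup := by
    rintro w x y z ⟨a, ha, h⟩ ⟨b, hb, k⟩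
    refine ⟨a ⊔ b, Order.Ideal.sup_mem ha hb, ?_⟩
    rw [sup_sup_sup_comm, h, k, sup_sup_sup_comm]

end DistribLattice

/-- Filt-BLP: the congruence of every filter has the Boolean Lifting Property. -/
def HasFiltBLP (L : Type u) [DistribLattice L] [BoundedOrder L] : Prop :=
  ∀ F : Order.PFilter L, LatConHasBLP (filterCon F)

/-- Id-BLP: the congruence of every ideal has the Boolean Lifting Property. -/
def HasIdBLP (L : Type u) [DistribLattice L] [BoundedOrder L] : Prop :=
  ∀ I : Order.Ideal L, LatConHasBLP (idealCon I)

/-! ### Residuated lattices -/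

/-- A (bounded, commutative, integral) residuated lattice `(A, ⊔, ⊓, *, ⇨, ⊥, ⊤)`; the unit of the
product is the top element. -/
class ResiduatedLattice (A : Type u) extends Lattice A, BoundedOrder A, CommMonoid A, HImp A where
  one_eq_top : (1 : A) = ⊤
  le_himp_iff' : ∀ a b c : A, a ≤ b ⇨ c ↔ a * b ≤ c

section Arithmetic

variable {A : Type u} [ResiduatedLattice A]

theorem resid {a b c : A} : a ≤ b ⇨ c ↔ a * b ≤ c := ResiduatedLattice.le_himp_iff' a b c

theorem mul_le_mul_r {a b : A} (h : a ≤ b) (c : A) : a * c ≤ b * c :=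
  resid.1 (h.trans (resid.2 le_rfl))

theorem mul_le_mul_both {a b c d : A} (h : a ≤ b) (k : c ≤ d) : a * c ≤ b * d := by
  refine (mul_le_mul_r h c).trans ?_
  rw [mul_comm b c, mul_comm b d]
  exact mul_le_mul_r k b

theorem mul_le_l (a b : A) : a * b ≤ a := by
  have h : b ≤ 1 := by
    rw [ResiduatedLattice.one_eq_top]
    exact le_top
  simpa using mul_le_mul_both (le_refl a) h

theorem mul_le_r (a b : A) : a * b ≤ b := by
  rw [mul_comm]
  exact mul_le_l b a

theorem himp_mul_le (a b : A) : (a ⇨ b) * a ≤ b := resid.1 le_rfl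

theorem mul_sup_le {a b c d : A} (h : a * b ≤ d) (k : a * c ≤ d) : a * (b ⊔ c) ≤ d := by
  rw [mul_comm, ← resid]
  refine sup_le ?_ ?_
  · rw [resid, mul_comm]
    exact h
  · rw [resid, mul_comm]
    exact k

theorem sup_mul_sup_le (a b c : A) : (a ⊔ b) * (a ⊔ c) ≤ a ⊔ b * c := by
  refine mul_sup_le ((mul_le_r _ _).trans le_sup_left) ?_
  rw [mul_comm]
  refine mul_sup_le ((mul_le_r _ _).trans le_sup_left) ?_
  rw [mul_comm]
  exact le_sup_right

theorem himp_self_top (a : A) : a ⇨ a = ⊤ :=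
  top_le_iff.1 (resid.2 (mul_le_r _ _))

end Arithmetic

/-! ### Filters and principal filters of a residuated lattice -/

/-- Filters of a residuated lattice: nonempty, closed under the product, upward closed. -/
structure Filt (A : Type u) [ResiduatedLattice A] where
  carrier : Set A
  nonempty' : carrier.Nonempty
  mul_mem' : ∀ {x y : A}, x ∈ carrier → y ∈ carrier → x * y ∈ carrier
  mem_of_le' : ∀ {x y : A}, x ∈ carrier → x ≤ y → y ∈ carrier

namespace Filt

variable {A : Type u} [ResiduatedLattice A]

instance : SetLike (Filt A) A where
  coe := carrier
  coe_injective := by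
    rintro ⟨⟩ ⟨⟩ h
    congr

/-- Filters are ordered by inclusion. -/
instance : PartialOrder (Filt A) := PartialOrder.ofSetLike (Filt A) A

theorem mul_mem {F : Filt A} {x y : A} (hx : x ∈ F) (hy : y ∈ F) : x * y ∈ F := F.mul_mem' hx hy

theorem mem_of_le {F : Filt A} {x y : A} (hx : x ∈ F) (h : x ≤ y) : y ∈ F := F.mem_of_le' hx h

theorem top_mem (F : Filt A) : (⊤ : A) ∈ F := mem_of_le F.nonempty'.some_mem le_top

theorem inf_mem_iff {F : Filt A} {x y : A} : x ⊓ y ∈ F ↔ x ∈ F ∧ y ∈ F :=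
  ⟨fun h => ⟨mem_of_le h inf_le_left, mem_of_le h inf_le_right⟩,
    fun h => mem_of_le (mul_mem h.1 h.2) (le_inf (mul_le_l _ _) (mul_le_r _ _))⟩

instance : InfSet (Filt A) where
  sInf S :=
    { carrier := {x | ∀ F ∈ S, x ∈ F}
      nonempty' := ⟨⊤, fun F _ => top_mem F⟩
      mul_mem' := fun hx hy F hF => mul_mem (hx F hF) (hy F hF)
      mem_of_le' := fun hx h F hF => mem_of_le (hx F hF) h }

theorem mem_sInf {S : Set (Filt A)} {x : A} : x ∈ sInf S ↔ ∀ F ∈ S, x ∈ F := Iff.rfl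

/-- Meets are intersections; the join of a family is the least filter including its members. -/
instance : CompleteLattice (Filt A) :=
  completeLatticeOfInf (Filt A) fun _ =>
    ⟨fun F hF _ hx => hx F hF, fun _ hG _ hx F hF => hG hF hx⟩

/-- The filter `[X)` generated by `X`: the least filter including `X`. -/
def generate (X : Set A) : Filt A := sInf {F | X ⊆ (F : Set A)}

/-- The principal filter `[x)`. -/
def principal (x : A) : Filt A := generate {x}

theorem mem_principal_self (x : A) : x ∈ principal x :=
  fun _ hF => hF rfl

theorem principal_le {x : A} {F : Filt A} : principal x ≤ F ↔ x ∈ F :=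
  ⟨fun h => h (mem_principal_self x),
    fun h _ hy => hy F (Set.singleton_subset_iff.2 h)⟩

theorem principal_sup (x y : A) : principal x ⊔ principal y = principal (x * y) := by
  apply le_antisymm
  · refine sup_le (principal_le.2 ?_) (principal_le.2 ?_)
    · exact mem_of_le (mem_principal_self _) (mul_le_l _ _)
    · exact mem_of_le (mem_principal_self _) (mul_le_r _ _)
  · refine principal_le.2 (mul_mem ?_ ?_)
    · exact (le_sup_left : principal x ≤ principal x ⊔ principal y) (mem_principal_self x)
    · exact (le_sup_right : principal y ≤ principal x ⊔ principal y) (mem_principal_self y)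

/-- The filter `{t | x ⊔ t ∈ F}`. -/
def residual (F : Filt A) (x : A) : Filt A where
  carrier := {t | x ⊔ t ∈ F}
  nonempty' := ⟨⊤, mem_of_le F.top_mem le_sup_right⟩
  mul_mem' := fun hs ht => mem_of_le (mul_mem hs ht) (sup_mul_sup_le _ _ _)
  mem_of_le' := fun hs h => mem_of_le hs (sup_le_sup_left h _)

theorem principal_inf (x y : A) : principal x ⊓ principal y = principal (x ⊔ y) := by
  apply le_antisymm
  · intro z hz
    have hx : z ∈ principal x := (inf_le_left : principal x ⊓ principal y ≤ _) hz
    have hy : z ∈ principal y := (inf_le_right : principal x ⊓ principal y ≤ _) hz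
    have h₁ : principal y ≤ residual (principal (x ⊔ y)) x :=
      principal_le.2 (mem_principal_self (x ⊔ y))
    have h₂ : principal x ≤ residual (principal (x ⊔ y)) z := by
      refine principal_le.2 ?_
      have : x ⊔ z ∈ principal (x ⊔ y) := h₁ hy
      change z ⊔ x ∈ principal (x ⊔ y)
      rwa [sup_comm z x]
    have h₃ : z ⊔ z ∈ principal (x ⊔ y) := h₂ hx
    rwa [sup_idem] at h₃
  · refine le_inf (principal_le.2 ?_) (principal_le.2 ?_)
    · exact mem_of_le (mem_principal_self x) le_sup_left
    · exact mem_of_le (mem_principal_self y) le_sup_right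

theorem principal_top : principal (⊤ : A) = ⊥ :=
  le_bot_iff.1 (principal_le.2 (top_mem _))

theorem principal_bot : principal (⊥ : A) = ⊤ :=
  top_le_iff.1 fun _ _ => mem_of_le (mem_principal_self ⊥) bot_le

end Filt

/-- The sublattice of principal filters. -/
def principalSublattice (A : Type u) [ResiduatedLattice A] : Sublattice (Filt A) where
  carrier := Set.range Filt.principal
  supClosed' := by
    rintro _ ⟨x, rfl⟩ _ ⟨y, rfl⟩
    exact ⟨x * y, (Filt.principal_sup x y).symm⟩
  infClosed' := by
    rintro _ ⟨x, rfl⟩ _ ⟨y, rfl⟩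
    exact ⟨x ⊔ y, (Filt.principal_inf x y).symm⟩

/-- `PFilt(A)`: the principal filters of `A`. -/
def PFilt (A : Type u) [ResiduatedLattice A] : Type u := principalSublattice A

instance (A : Type u) [ResiduatedLattice A] : Lattice (PFilt A) :=
  inferInstanceAs (Lattice (principalSublattice A))

/-- `PFilt(A)` is a bounded distributive sublattice of `Filt(A)`. -/
instance (A : Type u) [ResiduatedLattice A] : DistribLattice (PFilt A) :=
  DistribLattice.ofInfSupLe (by
    rintro ⟨_, x, rfl⟩ ⟨_, y, rfl⟩ ⟨_, z, rfl⟩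
    change Filt.principal x ⊓ (Filt.principal y ⊔ Filt.principal z) ≤
      (Filt.principal x ⊓ Filt.principal y) ⊔ (Filt.principal x ⊓ Filt.principal z)
    rw [Filt.principal_sup, Filt.principal_inf, Filt.principal_inf, Filt.principal_inf,
      Filt.principal_sup, Filt.principal_le]
    exact Filt.mem_of_le (Filt.mem_principal_self _) (sup_mul_sup_le x y z))

instance (A : Type u) [ResiduatedLattice A] : BoundedOrder (PFilt A) where
  top := ⟨⊤, ⊥, Filt.principal_bot⟩
  bot := ⟨⊥, ⊤, Filt.principal_top⟩
  le_top F := (le_top : F.1 ≤ ⊤)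
  bot_le F := (bot_le : ⊥ ≤ F.1)

/-! ### Congruences of a residuated lattice and quotients -/

/-- Congruences of a residuated lattice: equivalences compatible with all the operations. -/
structure ResCon (A : Type u) [ResiduatedLattice A] extends LatticeCon A where
  mul : ∀ {w x y z}, r w x → r y z → r (w * y) (x * z)
  himp : ∀ {w x y z}, r w x → r y z → r (w ⇨ y) (x ⇨ z)

namespace ResCon

variable {A : Type u} [ResiduatedLattice A]

theorem ext {θ φ : ResCon A} (h : ∀ x y, θ.r x y ↔ φ.r x y) : θ = φ := by
  obtain ⟨⟨⟨r, hr⟩, i, s⟩, m, k⟩ := θ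
  obtain ⟨⟨⟨r', hr'⟩, i', s'⟩, m', k'⟩ := φ
  have : r = r' := by
    funext x y
    exact propext (h x y)
  subst this
  rfl

/-- Congruences are ordered by inclusion. -/
instance : PartialOrder (ResCon A) where
  le θ φ := ∀ ⦃x y : A⦄, θ.r x y → φ.r x y
  le_refl _ _ _ h := h
  le_trans _ _ _ h k _ _ hx := k (h hx)
  le_antisymm _ _ h k := ResCon.ext fun _ _ => ⟨fun hx => h hx, fun hx => k hx⟩

instance : InfSet (ResCon A) where
  sInf S :=
    { r := fun x y => ∀ θ ∈ S, θ.r x y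
      iseqv :=
        { refl := fun x θ _ => θ.iseqv.refl x
          symm := fun h θ hθ => θ.symm (h θ hθ)
          trans := fun h k θ hθ => θ.trans (h θ hθ) (k θ hθ) }
      inf := fun h k θ hθ => θ.inf (h θ hθ) (k θ hθ)
      sup := fun h k θ hθ => θ.sup (h θ hθ) (k θ hθ)
      mul := fun h k θ hθ => θ.mul (h θ hθ) (k θ hθ)
      himp := fun h k θ hθ => θ.himp (h θ hθ) (k θ hθ) }

/-- Meets are intersections; the join of a family is the least congruence including its members. -/
instance : CompleteLattice (ResCon A) :=
  completeLatticeOfInf (ResCon A) fun _ =>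
    ⟨fun θ hθ _ _ hx => hx θ hθ, fun _ hφ _ _ hx θ hθ => hφ hθ hx⟩

/-- The quotient `A/θ`. -/
def Quot (θ : ResCon A) : Type u := LatQuot θ.toLatticeCon

/-- The canonical surjection `A → A/θ`. -/
def proj (θ : ResCon A) (x : A) : θ.Quot := LatQuot.mk θ.toLatticeCon x

instance (θ : ResCon A) : Lattice θ.Quot := inferInstanceAs (Lattice (LatQuot θ.toLatticeCon))

instance (θ : ResCon A) : BoundedOrder θ.Quot :=
  inferInstanceAs (BoundedOrder (LatQuot θ.toLatticeCon))

theorem ind {θ : ResCon A} {p : θ.Quot → Prop} (h : ∀ x, p (θ.proj x)) (q : θ.Quot) : p q :=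
  LatQuot.ind h q

theorem proj_eq_iff (θ : ResCon A) {x y : A} : θ.proj x = θ.proj y ↔ θ.r x y :=
  LatQuot.mk_eq_iff _

theorem proj_le_iff (θ : ResCon A) {x y : A} : θ.proj x ≤ θ.proj y ↔ θ.r (x ⊓ y) x :=
  LatQuot.mk_le_mk_iff _

theorem proj_mono (θ : ResCon A) {x y : A} (h : x ≤ y) : θ.proj x ≤ θ.proj y :=
  LatQuot.mk_mono _ h

instance (θ : ResCon A) : Mul θ.Quot where
  mul := Quotient.map₂ (· * ·) (fun _ _ h₁ _ _ h₂ => θ.mul h₁ h₂)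

instance (θ : ResCon A) : HImp θ.Quot where
  himp := Quotient.map₂ (· ⇨ ·) (fun _ _ h₁ _ _ h₂ => θ.himp h₁ h₂)

theorem proj_mul (θ : ResCon A) (x y : A) : θ.proj (x * y) = θ.proj x * θ.proj y := rfl

theorem proj_himp (θ : ResCon A) (x y : A) : θ.proj (x ⇨ y) = θ.proj x ⇨ θ.proj y := rfl

instance (θ : ResCon A) : CommMonoid θ.Quot where
  one := θ.proj 1
  mul_assoc a b c := by
    induction a using ResCon.ind with | _ a
    induction b using ResCon.ind with | _ b
    induction c using ResCon.ind with | _ c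
    simp only [← proj_mul, mul_assoc]
  mul_comm a b := by
    induction a using ResCon.ind with | _ a
    induction b using ResCon.ind with | _ b
    rw [← proj_mul, ← proj_mul, mul_comm]
  one_mul a := by
    induction a using ResCon.ind with | _ a
    change θ.proj (1 * a) = θ.proj a
    rw [one_mul]
  mul_one a := by
    induction a using ResCon.ind with | _ a
    change θ.proj (a * 1) = θ.proj a
    rw [mul_one]

theorem proj_resid (θ : ResCon A) (a b c : A) : θ.proj a ≤ θ.proj (b ⇨ c) ↔ θ.proj (a * b) ≤ θ.proj c := by
  constructor
  · intro h
    rw [proj_le_iff] at h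
    have h₁ : θ.proj (a * b) = θ.proj ((a ⊓ (b ⇨ c)) * b) :=
      (proj_eq_iff θ).2 (θ.mul (θ.symm h) (θ.refl b))
    rw [h₁]
    exact θ.proj_mono (resid.1 inf_le_right)
  · intro h
    rw [proj_le_iff] at h
    have h₁ : θ.proj (b ⇨ (a * b)) = θ.proj (b ⇨ (a * b ⊓ c)) :=
      (proj_eq_iff θ).2 (θ.himp (θ.refl b) (θ.symm h))
    have h₂ : θ.proj a ≤ θ.proj (b ⇨ (a * b)) := θ.proj_mono (resid.2 le_rfl)
    refine (h₂.trans h₁.le).trans (θ.proj_mono ?_)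
    exact resid.2 ((himp_mul_le _ _).trans inf_le_right)

/-- The quotient residuated lattice, with the operations induced from `A`. -/
instance (θ : ResCon A) : ResiduatedLattice θ.Quot where
  one_eq_top := by
    change θ.proj 1 = θ.proj ⊤
    rw [ResiduatedLattice.one_eq_top]
  le_himp_iff' a b c := by
    induction a using ResCon.ind with | _ a
    induction b using ResCon.ind with | _ b
    induction c using ResCon.ind with | _ c
    exact θ.proj_resid a b c

/-- For `θ ≤ φ`, the congruence `φ/θ = {(a/θ, b/θ) | (a, b) ∈ φ}` of `A/θ`. -/
def quotCon (θ φ : ResCon A) (hle : θ ≤ φ) : ResCon θ.Quot where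
  r p q := ∃ a b, θ.proj a = p ∧ θ.proj b = q ∧ φ.r a b
  iseqv :=
    { refl := ResCon.ind fun a => ⟨a, a, rfl, rfl, φ.refl a⟩
      symm := fun ⟨a, b, ha, hb, h⟩ => ⟨b, a, hb, ha, φ.symm h⟩
      trans := by
        rintro _ _ _ ⟨a, b, rfl, rfl, h⟩ ⟨a', b', ha, rfl, k⟩
        exact ⟨a, b', rfl, rfl, φ.trans h (φ.trans (hle (θ.symm ((proj_eq_iff θ).1 ha))) k)⟩ }
  inf := by
    rintro _ _ _ _ ⟨a, b, rfl, rfl, h⟩ ⟨a', b', rfl, rfl, k⟩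
    exact ⟨a ⊓ a', b ⊓ b', rfl, rfl, φ.inf h k⟩
  sup := by
    rintro _ _ _ _ ⟨a, b, rfl, rfl, h⟩ ⟨a', b', rfl, rfl, k⟩
    exact ⟨a ⊔ a', b ⊔ b', rfl, rfl, φ.sup h k⟩
  mul := by
    rintro _ _ _ _ ⟨a, b, rfl, rfl, h⟩ ⟨a', b', rfl, rfl, k⟩
    exact ⟨a * a', b * b', rfl, rfl, φ.mul h k⟩
  himp := by
    rintro _ _ _ _ ⟨a, b, rfl, rfl, h⟩ ⟨a', b', rfl, rfl, k⟩
    exact ⟨a ⇨ a', b ⇨ b', rfl, rfl, φ.himp h k⟩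

/-- The map `Con(A) → Con(A/θ)`, `α ↦ (α ⊔ θ)/θ`. -/
def toQuotCon (θ α : ResCon A) : ResCon θ.Quot := quotCon θ (α ⊔ θ) le_sup_right

/-- `θ` has CBLP: `α ↦ (α ⊔ θ)/θ` maps the Boolean center of `Con(A)` onto that of
`Con(A/θ)`. -/
def HasCBLP (θ : ResCon A) : Prop :=
  Set.SurjOn θ.toQuotCon (boolCenter (ResCon A)) (boolCenter (ResCon θ.Quot))

end ResCon

/-- The Congruence Boolean Lifting Property: all congruences of `A` have CBLP. -/
def HasCBLP (A : Type u) [ResiduatedLattice A] : Prop := ∀ θ : ResCon A, θ.HasCBLP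

namespace Filt

variable {A : Type u} [ResiduatedLattice A]

theorem biresid_mem_iff {F : Filt A} {x y : A} :
    (x ⇨ y) ⊓ (y ⇨ x) ∈ F ↔ (∃ p ∈ F, p * x ≤ y) ∧ (∃ p ∈ F, p * y ≤ x) := by
  rw [inf_mem_iff]
  constructor
  · exact fun h => ⟨⟨_, h.1, himp_mul_le _ _⟩, ⟨_, h.2, himp_mul_le _ _⟩⟩
  · rintro ⟨⟨p, hp, h⟩, ⟨q, hq, k⟩⟩
    exact ⟨mem_of_le hp (resid.2 h), mem_of_le hq (resid.2 k)⟩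

theorem le_sup_aux {p q w x y z : A} (h : p * w ≤ x) (k : q * y ≤ z) :
    p * q * (w ⊔ y) ≤ x ⊔ z := by
  refine mul_sup_le ?_ ?_
  · exact ((mul_le_mul_r (mul_le_l p q) w).trans h).trans le_sup_left
  · exact ((mul_le_mul_r (mul_le_r p q) y).trans k).trans le_sup_right

theorem le_inf_aux {p q w x y z : A} (h : p * w ≤ x) (k : q * y ≤ z) :
    p * q * (w ⊓ y) ≤ x ⊓ z :=
  le_inf ((mul_le_mul_both (mul_le_l p q) inf_le_left).trans h)
    ((mul_le_mul_both (mul_le_r p q) inf_le_right).trans k)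

theorem le_mul_aux {p q w x y z : A} (h : p * w ≤ x) (k : q * y ≤ z) :
    p * q * (w * y) ≤ x * z := by
  rw [mul_mul_mul_comm]
  exact mul_le_mul_both h k

theorem le_himp_aux {p q w x y z : A} (h : p * x ≤ w) (k : q * y ≤ z) :
    p * q * (w ⇨ y) ≤ x ⇨ z := by
  rw [resid]
  have e : p * q * (w ⇨ y) * x = q * ((w ⇨ y) * (p * x)) := by
    rw [mul_comm p q, mul_assoc, mul_assoc, mul_left_comm p]
  rw [e]
  refine (mul_le_mul_both (le_refl q) ?_).trans k
  exact (mul_le_mul_both le_rfl h).trans (himp_mul_le _ _)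

/-- The congruence `∼_F` of a filter `F`: `x ∼ y` iff `(x ⇨ y) ⊓ (y ⇨ x) ∈ F`. -/
def con (F : Filt A) : ResCon A where
  r x y := (x ⇨ y) ⊓ (y ⇨ x) ∈ F
  iseqv :=
    { refl := fun x => by
        rw [himp_self_top, inf_idem]
        exact F.top_mem
      symm := fun h => by
        rw [inf_comm]
        exact h
      trans := fun {x y z} h k => by
        rw [biresid_mem_iff] at h k ⊢
        obtain ⟨⟨p, hp, hxy⟩, ⟨p', hp', hyx⟩⟩ := h
        obtain ⟨⟨q, hq, hyz⟩, ⟨q', hq', hzy⟩⟩ := k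
        refine ⟨⟨q * p, mul_mem hq hp, ?_⟩, ⟨p' * q', mul_mem hp' hq', ?_⟩⟩
        · rw [mul_assoc]
          exact (mul_le_mul_both le_rfl hxy).trans hyz
        · rw [mul_assoc]
          exact (mul_le_mul_both le_rfl hzy).trans hyx }
  inf {w x y z} h k := by
    rw [biresid_mem_iff] at h k ⊢
    obtain ⟨⟨p, hp, h₁⟩, ⟨p', hp', h₂⟩⟩ := h
    obtain ⟨⟨q, hq, k₁⟩, ⟨q', hq', k₂⟩⟩ := k
    exact ⟨⟨p * q, mul_mem hp hq, le_inf_aux h₁ k₁⟩, ⟨p' * q', mul_mem hp' hq', le_inf_aux h₂ k₂⟩⟩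
  sup {w x y z} h k := by
    rw [biresid_mem_iff] at h k ⊢
    obtain ⟨⟨p, hp, h₁⟩, ⟨p', hp', h₂⟩⟩ := h
    obtain ⟨⟨q, hq, k₁⟩, ⟨q', hq', k₂⟩⟩ := k
    exact ⟨⟨p * q, mul_mem hp hq, le_sup_aux h₁ k₁⟩, ⟨p' * q', mul_mem hp' hq', le_sup_aux h₂ k₂⟩⟩
  mul {w x y z} h k := by
    rw [biresid_mem_iff] at h k ⊢
    obtain ⟨⟨p, hp, h₁⟩, ⟨p', hp', h₂⟩⟩ := h
    obtain ⟨⟨q, hq, k₁⟩, ⟨q', hq', k₂⟩⟩ := k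
    exact ⟨⟨p * q, mul_mem hp hq, le_mul_aux h₁ k₁⟩, ⟨p' * q', mul_mem hp' hq', le_mul_aux h₂ k₂⟩⟩
  himp {w x y z} h k := by
    rw [biresid_mem_iff] at h k ⊢
    obtain ⟨⟨p, hp, h₁⟩, ⟨p', hp', h₂⟩⟩ := h
    obtain ⟨⟨q, hq, k₁⟩, ⟨q', hq', k₂⟩⟩ := k
    exact ⟨⟨p' * q, mul_mem hp' hq, le_himp_aux h₂ k₁⟩,
      ⟨p * q', mul_mem hp hq', le_himp_aux h₁ k₂⟩⟩

/-- `F` has BLP: the canonical surjection `A → A/F` maps the Boolean center of `A` onto that of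
`A/F`. -/
def HasBLP (F : Filt A) : Prop :=
  Set.SurjOn F.con.proj (boolCenter A) (boolCenter F.con.Quot)

end Filt

/-- The Boolean Lifting Property: all filters of `A` have BLP. -/
def HasBLP (A : Type u) [ResiduatedLattice A] : Prop := ∀ F : Filt A, F.HasBLP

/-! ### Prime spectra and the reticulation -/

/-- The prime filters of a residuated lattice: proper filters `P` such that `x ⊔ y ∈ P` implies
`x ∈ P` or `y ∈ P`. -/
def ResSpec (A : Type u) [ResiduatedLattice A] : Type u :=
  {P : Filt A // P ≠ ⊤ ∧ ∀ x y : A, x ⊔ y ∈ P → x ∈ P ∨ y ∈ P}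

/-- The Stone topology, with the basis of the sets `{P | a ∉ P}`, `a ∈ A`. -/
instance (A : Type u) [ResiduatedLattice A] : TopologicalSpace (ResSpec A) :=
  TopologicalSpace.generateFrom (Set.range fun a : A => {P : ResSpec A | a ∉ P.1})

/-- The prime filters of a lattice. -/
def LatSpec (L : Type u) [Lattice L] : Type u :=
  {P : Order.PFilter L // P.IsPrime}

/-- The Stone topology, with the basis of the sets `{P | a ∉ P}`, `a ∈ L`. -/
instance (L : Type u) [Lattice L] : TopologicalSpace (LatSpec L) :=
  TopologicalSpace.generateFrom (Set.range fun a : L => {P : LatSpec L | a ∉ P.1})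

/-- The bounded distributive lattice `L` is a reticulation of `A`: the spaces of prime filters of
`A` and of `L`, with their Stone topologies, are homeomorphic. -/
def IsReticulation (A : Type u) [ResiduatedLattice A] (L : Type v) [DistribLattice L]
    [BoundedOrder L] : Prop :=
  Nonempty (ResSpec A ≃ₜ LatSpec L)

/-- The set of the prime filters of `A` that contain `a`. -/
def primesOver {A : Type u} [ResiduatedLattice A] (a : A) : Set (ResSpec A) := {P | a ∈ P.1}

theorem primesOver_mul {A : Type u} [ResiduatedLattice A] (a b : A) :
    primesOver (a * b) = primesOver a ∩ primesOver b := by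
  ext P
  exact ⟨fun h => ⟨Filt.mem_of_le h (mul_le_l _ _), Filt.mem_of_le h (mul_le_r _ _)⟩,
    fun h => Filt.mul_mem h.1 h.2⟩

theorem primesOver_sup {A : Type u} [ResiduatedLattice A] (a b : A) :
    primesOver (a ⊔ b) = primesOver a ∪ primesOver b := by
  ext P
  constructor
  · exact fun h => P.2.2 a b h
  · rintro (h | h)
    · exact Filt.mem_of_le h le_sup_left
    · exact Filt.mem_of_le h le_sup_right

theorem primesOver_top {A : Type u} [ResiduatedLattice A] :
    primesOver (⊤ : A) = Set.univ :=
  Set.eq_univ_of_forall fun P => P.1.top_mem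

theorem primesOver_bot {A : Type u} [ResiduatedLattice A] :
    primesOver (⊥ : A) = ∅ :=
  Set.eq_empty_of_forall_notMem fun P h =>
    P.2.1 (top_le_iff.1 fun _ _ => Filt.mem_of_le h bot_le)

/-- The sets `primesOver a` form a lattice of sets. -/
def reticulationSublattice (A : Type u) [ResiduatedLattice A] : Sublattice (Set (ResSpec A)) where
  carrier := Set.range primesOver
  supClosed' := by
    rintro _ ⟨a, rfl⟩ _ ⟨b, rfl⟩
    exact ⟨a ⊔ b, primesOver_sup a b⟩
  infClosed' := by
    rintro _ ⟨a, rfl⟩ _ ⟨b, rfl⟩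
    exact ⟨a * b, primesOver_mul a b⟩

/-- The reticulation of `A`: the quotient of `A` that identifies two elements iff they
belong to the same prime filters, realized as the lattice of the sets `primesOver a`. -/
def Reticulation (A : Type u) [ResiduatedLattice A] : Type u := reticulationSublattice A

instance (A : Type u) [ResiduatedLattice A] : DistribLattice (Reticulation A) :=
  inferInstanceAs (DistribLattice (reticulationSublattice A))

instance (A : Type u) [ResiduatedLattice A] : BoundedOrder (Reticulation A) where
  top := ⟨Set.univ, ⊤, primesOver_top⟩
  bot := ⟨∅, ⊥, primesOver_bot⟩
  le_top U := Set.subset_univ U.1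
  bot_le U := Set.empty_subset U.1

end ResLat

namespace ResLat

/-! ### Boolean centers under isomorphisms and lattice quotients -/

section BoundedLattice

/-! The complemented filters of `A` are exactly the principal filters of complemented elements
(`Filt.boolCenter_eq_image`), and congruences correspond to filters (`resConIso`). The conditions on
`A` therefore come down to one statement about elements: if `x * y = ⊥`, then the filters generated
by `x` and `y` contain complementary elements `e` and `e'`.

BLP implies this, even for arbitrary filters with `F ⊔ G = ⊤`, by lifting a complemented class from
the quotient by `F ⊓ G` (`HasBLP.containsCompl`). Conversely, in a quotient where `a` and `b` become
complementary, the elements `e` and `e'` found for suitable representatives are forced onto their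
classes (`hasBLP_of_containsCompl`). CBLP is BLP read through the map from complemented elements to
complemented congruences (`ResCon.hasCBLP_iff`).

The remaining conditions are lattice theory. For bounded distributive lattices Id-BLP is B-normality
and Filt-BLP is B-conormality. A bounded distributive lattice is recovered from its prime filter
space as the dual of the compact open sets (`LatSpec.compactOpensIso`), so all reticulations are
isomorphic. The concrete one is dual to `PFilt A`, because prime filters of `A` separate principal
filters (`primesOver_subset_iff`). -/

theorem BNormal.of_orderIso {L : Type u} {M : Type v} [Lattice L] [BoundedOrder L] [Lattice M]
    [BoundedOrder M] (i : L ≃o M) (h : BNormal L) : BNormal M := by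
  have hc {e : L} (he : e ∈ boolCenter L) : i e ∈ boolCenter M :=
    he.imp' i fun _ => i.isCompl_iff.1
  intro x y hxy
  obtain ⟨e, he, f, hf, hef, hxe, hyf⟩ := h (i.symm x) (i.symm y) (by rw [← map_sup, hxy, map_top])
  refine ⟨i e, hc he, i f, hc hf, ?_, ?_, ?_⟩
  · rw [← map_inf, hef, map_bot]
  · rw [← i.apply_symm_apply x, ← map_sup, hxe, map_top]
  · rw [← i.apply_symm_apply y, ← map_sup, hyf, map_top]

theorem bNormal_congr {L : Type u} {M : Type v} [Lattice L] [BoundedOrder L] [Lattice M]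
    [BoundedOrder M] (i : L ≃o M) : BNormal L ↔ BNormal M :=
  ⟨.of_orderIso i, .of_orderIso i.symm⟩

theorem LatQuot.isCompl_mk {L : Type u} [Lattice L] [BoundedOrder L] (c : LatticeCon L) {x y : L}
    (h : IsCompl x y) : IsCompl (LatQuot.mk c x) (LatQuot.mk c y) := by
  refine IsCompl.of_eq ?_ ?_
  · rw [← LatQuot.mk_inf, h.inf_eq_bot]
    rfl
  · rw [← LatQuot.mk_sup, h.sup_eq_top]
    rfl

theorem LatQuot.isCompl_mk_iff {L : Type u} [Lattice L] [BoundedOrder L] (c : LatticeCon L)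
    {x y : L} : IsCompl (LatQuot.mk c x) (LatQuot.mk c y) ↔ c.r (x ⊓ y) ⊥ ∧ c.r (x ⊔ y) ⊤ := by
  rw [isCompl_iff, disjoint_iff, codisjoint_iff, ← LatQuot.mk_inf, ← LatQuot.mk_sup,
    ← LatQuot.mk_eq_iff, ← LatQuot.mk_eq_iff]
  rfl

/-- Images of complemented elements are always complemented, so only the lifting of complemented
classes has content; here it is expressed by representatives. -/
theorem latConHasBLP_iff {L : Type u} [Lattice L] [BoundedOrder L] (c : LatticeCon L) :
    LatConHasBLP c ↔ ∀ x y : L, c.r (x ⊓ y) ⊥ → c.r (x ⊔ y) ⊤ →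
      ∃ e e' : L, IsCompl e e' ∧ c.r e x := by
  constructor
  · intro h x y hi hs
    have hx : LatQuot.mk c x ∈ boolCenter (LatQuot c) :=
      ⟨LatQuot.mk c y, (LatQuot.isCompl_mk_iff c).2 ⟨hi, hs⟩⟩
    rw [h] at hx
    obtain ⟨e, ⟨e', he⟩, hex⟩ := hx
    exact ⟨e, e', he, (LatQuot.mk_eq_iff c).1 hex⟩
  · intro h
    refine Set.Subset.antisymm ?_ ?_
    · rintro q ⟨r, hqr⟩
      induction q using LatQuot.ind with | _ x
      induction r using LatQuot.ind with | _ y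
      obtain ⟨hi, hs⟩ := (LatQuot.isCompl_mk_iff c).1 hqr
      obtain ⟨e, e', he, hex⟩ := h x y hi hs
      exact ⟨e, ⟨e', he⟩, (LatQuot.mk_eq_iff c).2 hex⟩
    · rintro _ ⟨e, ⟨e', he⟩, rfl⟩
      exact ⟨_, LatQuot.isCompl_mk c he⟩

end BoundedLattice

/-! ### B-normality and the lifting properties in distributive lattices -/

section BoundedDistribLattice

variable {L : Type u} [DistribLattice L] [BoundedOrder L]

/-- By distributivity `x ⊔ e = ⊤` puts the complement of `e` below `x`, while `y ⊔ f = ⊤` and `e ⊓ f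
= ⊥` put `e` below `y`. One complementary pair thus replaces `e` and `f`. -/
theorem bNormal_iff_exists_isCompl :
    BNormal L ↔ ∀ x y : L, x ⊔ y = ⊤ → ∃ e e' : L, IsCompl e e' ∧ e ≤ x ∧ e' ≤ y := by
  constructor
  · intro h x y hxy
    obtain ⟨e, ⟨e', he⟩, f, -, hef, hxe, hyf⟩ := h x y hxy
    refine ⟨e', e, he.symm, ?_, ?_⟩
    · exact he.symm.disjoint.le_of_codisjoint (codisjoint_iff.2 (sup_comm x e ▸ hxe))
    · exact (disjoint_iff.2 hef).le_of_codisjoint (codisjoint_iff.2 (sup_comm y f ▸ hyf))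
  · intro h x y hxy
    obtain ⟨e, e', he, hx, hy⟩ := h x y hxy
    refine ⟨e', ⟨e, he.symm⟩, e, ⟨e', he⟩, he.symm.inf_eq_bot, ?_, ?_⟩
    · exact top_le_iff.1 (he.sup_eq_top.ge.trans (sup_le_sup_right hx _))
    · exact top_le_iff.1 (he.symm.sup_eq_top.ge.trans (sup_le_sup_right hy _))

theorem bConormal_iff_exists_isCompl :
    BConormal L ↔ ∀ x y : L, x ⊓ y = ⊥ → ∃ e e' : L, IsCompl e e' ∧ x ≤ e ∧ y ≤ e' := by
  refine (bNormal_iff_exists_isCompl (L := Lᵒᵈ)).trans ?_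
  constructor
  · intro h x y hxy
    obtain ⟨e, e', he, hx, hy⟩ := h (OrderDual.toDual x) (OrderDual.toDual y) hxy
    exact ⟨OrderDual.ofDual e, OrderDual.ofDual e', he.ofDual, hx, hy⟩
  · intro h x y hxy
    obtain ⟨e, e', he, hx, hy⟩ := h (OrderDual.ofDual x) (OrderDual.ofDual y) hxy
    exact ⟨OrderDual.toDual e, OrderDual.toDual e', he.dual, hx, hy⟩

theorem idealCon_bot_iff {I : Order.Ideal L} {x : L} : (idealCon I).r x ⊥ ↔ x ∈ I := by
  constructor
  · rintro ⟨a, ha, h⟩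
    rw [bot_sup_eq] at h
    exact I.lower (sup_eq_right.1 h) ha
  · exact fun h => ⟨x, h, by simp⟩

theorem filterCon_top_iff {F : Order.PFilter L} {x : L} : (filterCon F).r x ⊤ ↔ x ∈ F := by
  constructor
  · rintro ⟨a, ha, h⟩
    rw [top_inf_eq] at h
    exact Order.PFilter.mem_of_le (inf_eq_right.1 h) ha
  · exact fun h => ⟨x, h, by simp⟩

/-- If `x ⊔ y = ⊤`, then `x` and `y` are complementary modulo the ideal below `x ⊓ y`, and a lift of
the class of `x` splits the cover. Conversely, if `x` and `y` are complementary modulo `I`, some `a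
∈ I` gives `x ⊔ (y ⊔ a) = ⊤`, and a splitting of this cover lifts `x`. -/
theorem hasIdBLP_iff_bNormal : HasIdBLP L ↔ BNormal L := by
  rw [bNormal_iff_exists_isCompl]
  refine ⟨fun h x y hxy => ?_, fun h I => (latConHasBLP_iff _).2 fun x y hi hs => ?_⟩
  · obtain ⟨e, e', he, a, ha, hea⟩ := (latConHasBLP_iff _).1 (h (.principal (x ⊓ y))) x y
      (idealCon_bot_iff.2 (Order.Ideal.mem_principal.2 le_rfl))
      (hxy ▸ (idealCon _).refl _)
    rw [Order.Ideal.mem_principal, le_inf_iff] at ha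
    have hex : e ⊔ a = x := hea.trans (sup_eq_left.2 ha.1)
    refine ⟨e, e', he, hex ▸ le_sup_left, ?_⟩
    refine he.symm.disjoint.le_of_codisjoint (codisjoint_iff.2 (top_le_iff.1 ?_))
    rw [← hxy, ← hex]
    exact sup_le (sup_le le_sup_left (ha.2.trans le_sup_right)) le_sup_right
  · rw [idealCon_bot_iff] at hi
    obtain ⟨a, ha, hs⟩ := hs
    rw [top_sup_eq, sup_assoc] at hs
    obtain ⟨e, e', he, hex, hey⟩ := h _ _ hs
    refine ⟨e, e', he, (x ⊓ y) ⊔ a, Order.Ideal.sup_mem hi ha, le_antisymm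
      (sup_le_sup_right hex _) (sup_le ?_ le_sup_right)⟩
    -- Writing `x = x ⊓ (e ⊔ e')` bounds the part of `x` outside `e` by `x ⊓ (y ⊔ a)`, hence by `(x
    -- ⊓ y) ⊔ a`.
    refine le_trans (le_inf le_rfl le_top) ?_
    rw [← he.sup_eq_top, inf_sup_left]
    refine sup_le_sup inf_le_right ((inf_le_inf_left x hey).trans ?_)
    rw [inf_sup_left]
    exact sup_le_sup_left inf_le_right _

theorem hasFiltBLP_iff_bConormal : HasFiltBLP L ↔ BConormal L := by
  rw [bConormal_iff_exists_isCompl]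
  refine ⟨fun h x y hxy => ?_, fun h F => (latConHasBLP_iff _).2 fun x y hi hs => ?_⟩
  · obtain ⟨e, e', he, a, ha, hea⟩ := (latConHasBLP_iff _).1 (h (.principal (x ⊔ y))) x y
      (hxy ▸ (filterCon _).refl _)
      (filterCon_top_iff.2 (Order.PFilter.mem_principal.2 le_rfl))
    rw [Order.PFilter.mem_principal, sup_le_iff] at ha
    have hex : e ⊓ a = x := hea.trans (inf_eq_left.2 ha.1)
    refine ⟨e, e', he, hex ▸ inf_le_left, ?_⟩
    refine (disjoint_iff.2 (le_bot_iff.1 ?_)).le_of_codisjoint he.codisjoint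
    rw [← hxy, ← hex]
    exact le_inf (le_inf inf_le_right (inf_le_left.trans ha.2)) inf_le_left
  · rw [filterCon_top_iff] at hs
    obtain ⟨a, ha, hi⟩ := hi
    rw [bot_inf_eq, inf_assoc] at hi
    obtain ⟨e, e', he, hex, hey⟩ := h _ _ hi
    refine ⟨e, e', he, (x ⊔ y) ⊓ a, Order.PFilter.inf_mem hs ha, le_antisymm
      (le_inf ?_ inf_le_right) (inf_le_inf_right _ hex)⟩
    -- Dually, `x = x ⊔ (e ⊓ e')` is split by distributivity.
    refine le_trans ?_ (sup_le le_rfl bot_le : x ⊔ ⊥ ≤ x)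
    rw [← he.inf_eq_bot, sup_inf_left]
    refine le_inf (inf_le_left.trans le_sup_right) ?_
    rw [inf_sup_right, inf_sup_left]
    exact sup_le (inf_le_right.trans (inf_le_left.trans le_sup_left))
      (inf_le_right.trans (hey.trans le_sup_right))

end BoundedDistribLattice

/-! ### Recovering a distributive lattice from its prime filter space -/

section LatticeSpectrum

open TopologicalSpace

variable {L : Type u} [DistribLattice L]

/-- The basic open set `{P | a ∉ P}` of the spectrum of a lattice. -/
def LatSpec.basicOpen (a : L) : Set (LatSpec L) := {P | a ∉ P.1}

theorem LatSpec.sup_mem_iff (P : LatSpec L) {a b : L} : a ⊔ b ∈ P.1 ↔ a ∈ P.1 ∨ b ∈ P.1 := by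
  refine ⟨fun h => ?_, ?_⟩
  · by_contra! hab
    exact (Order.Ideal.sup_mem (s := P.2.compl_ideal.toIdeal) hab.1 hab.2) h
  · rintro (h | h)
    · exact Order.PFilter.mem_of_le le_sup_left h
    · exact Order.PFilter.mem_of_le le_sup_right h

theorem LatSpec.exists_of_disjoint {F : Order.PFilter L} {I : Order.Ideal L}
    (h : Disjoint (F : Set L) (I : Set L)) :
    ∃ P : LatSpec L, F ≤ P.1 ∧ ∀ a ∈ I, a ∉ P.1 := by
  obtain ⟨J, hJ, hIJ, hFJ⟩ := DistribLattice.prime_ideal_of_disjoint_filter_ideal h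
  exact ⟨⟨hJ.toPrimePair.F, hJ.toPrimePair.F_isPrime⟩,
    fun x hx hxJ => Set.disjoint_left.1 hFJ hx hxJ, fun a ha ha' => ha' (hIJ ha)⟩

/-- If `b ≤ a` fails, the filter above `b` and the ideal below `a` are disjoint, and the prime ideal
theorem yields a prime filter containing `b` but not `a`. The order is reversed since a basic open
set consists of the filters that omit the element. -/
theorem LatSpec.basicOpen_subset_iff {a b : L} : basicOpen a ⊆ basicOpen b ↔ b ≤ a := by
  refine ⟨fun h => ?_, fun h P ha hb => ha (Order.PFilter.mem_of_le h hb)⟩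
  by_contra hba
  obtain ⟨P, hbP, haP⟩ := exists_of_disjoint (F := .principal b) (I := .principal a)
    (Set.disjoint_left.2 fun x hb ha =>
      hba ((Order.PFilter.mem_principal.1 hb).trans (Order.Ideal.mem_principal.1 ha)))
  exact h (haP a (Order.Ideal.mem_principal.2 le_rfl)) (Order.PFilter.principal_le_iff.1 hbP)

theorem LatSpec.isOpen_basicOpen (a : L) : IsOpen (basicOpen a) :=
  isOpen_generateFrom_of_mem ⟨a, rfl⟩

theorem LatSpec.basicOpen_inf (a b : L) : basicOpen (a ⊓ b) = basicOpen a ∪ basicOpen b := by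
  ext P
  simp only [basicOpen, Set.mem_ofPred_eq, Set.mem_union, Order.PFilter.inf_mem_iff, not_and_or]

theorem LatSpec.basicOpen_sup (a b : L) : basicOpen (a ⊔ b) = basicOpen a ∩ basicOpen b := by
  ext P
  simp only [basicOpen, Set.mem_ofPred_eq, Set.mem_inter_iff, P.sup_mem_iff, not_or]

variable [BoundedOrder L]

theorem LatSpec.bot_notMem (P : LatSpec L) : ⊥ ∉ P.1 :=
  Order.Ideal.bot_mem P.2.compl_ideal.toIdeal

theorem LatSpec.basicOpen_finset_inf (t : Finset L) :
    basicOpen (t.inf id) = ⋃ b ∈ t, basicOpen b := by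
  induction t using Finset.cons_induction with
  | empty =>
    ext P
    simp [basicOpen]
  | cons b t hb ih => simp [Finset.inf_cons, basicOpen_inf, ih]

theorem LatSpec.isTopologicalBasis_basicOpen :
    IsTopologicalBasis (Set.range (basicOpen : L → Set (LatSpec L))) :=
  isTopologicalBasis_of_subbasis_of_finiteInter rfl
    { univ_mem := ⟨⊥, Set.eq_univ_of_forall bot_notMem⟩
      inter_mem := by
        rintro _ ⟨a, rfl⟩ _ ⟨b, rfl⟩
        exact ⟨a ⊔ b, basicOpen_sup a b⟩ }

/-- The filter generated by a subset of a bounded lattice. -/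
def generatedPFilter (T : Set L) : Order.PFilter L :=
  Order.IsPFilter.toPFilter (F := {x | ∃ t : Finset L, ↑t ⊆ T ∧ t.inf id ≤ x}) <| by
    classical
    refine .of_def ⟨⊤, ∅, by simp⟩ ?_ ?_
    · rintro x ⟨t, ht, hx⟩ y ⟨s, hs, hy⟩
      refine ⟨x ⊓ y, ⟨t ∪ s, by simp [ht, hs], ?_⟩, inf_le_left, inf_le_right⟩
      rw [Finset.inf_union]
      exact inf_le_inf hx hy
    · rintro x y hxy ⟨t, ht, hx⟩
      exact ⟨t, ht, hx.trans hxy⟩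

theorem mem_generatedPFilter {T : Set L} {x : L} :
    x ∈ generatedPFilter T ↔ ∃ t : Finset L, ↑t ⊆ T ∧ t.inf id ≤ x := Iff.rfl

/-- By Alexander's subbasis theorem only covers by sets `basicOpen b` matter. If `a` lies in the
filter generated by these `b`, finitely many of them cover; otherwise a prime filter that extends
this filter and omits `a` is left uncovered. -/
theorem LatSpec.isCompact_basicOpen (a : L) : IsCompact (basicOpen a) := by
  refine isCompact_generateFrom rfl fun S hS haS => ?_
  by_cases ha : a ∈ generatedPFilter {b | basicOpen b ∈ S}
  · obtain ⟨t, ht, hta⟩ := mem_generatedPFilter.1 ha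
    refine ⟨basicOpen '' t, Set.image_subset_iff.2 ht, t.finite_toSet.image _, ?_⟩
    rw [Set.sUnion_image]
    exact (basicOpen_subset_iff.2 hta).trans (basicOpen_finset_inf t).subset
  · obtain ⟨P, hFP, haP⟩ := exists_of_disjoint (I := .principal a)
      (Set.disjoint_left.2 fun x hx hxa =>
        ha (Order.PFilter.mem_of_le (Order.Ideal.mem_principal.1 hxa) hx))
    obtain ⟨_, hU, hPU⟩ := haS (haP a (Order.Ideal.mem_principal.2 le_rfl))
    obtain ⟨b, rfl⟩ := hS hU
    exact (hPU (hFP (mem_generatedPFilter.2 ⟨{b}, by rwa [Finset.coe_singleton, Set.singleton_subset_iff], by simp⟩))).elim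

/-- A compact open set is a finite union of basic ones, and such a union is again basic, given by
the meet of the elements. -/
theorem LatSpec.exists_eq_basicOpen {U : Set (LatSpec L)} (ho : IsOpen U) (hc : IsCompact U) :
    ∃ a : L, basicOpen a = U := by
  obtain ⟨s, hs, rfl⟩ :=
    (isCompact_open_iff_eq_finite_iUnion_of_isTopologicalBasis _
      isTopologicalBasis_basicOpen isCompact_basicOpen U).1
      ⟨hc, ho⟩
  lift s to Finset L using hs
  exact ⟨s.inf id, basicOpen_finset_inf s⟩

/-- A bounded distributive lattice is dually isomorphic to the lattice of the compact open subsets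
of its spectrum. -/
noncomputable def LatSpec.compactOpensIso : L ≃o (CompactOpens (LatSpec L))ᵒᵈ :=
  RelIso.ofSurjective (r := (· ≤ ·)) (s := (· ≤ ·))
    { toFun := fun a => OrderDual.toDual ⟨⟨basicOpen a, isCompact_basicOpen a⟩, isOpen_basicOpen a⟩
      inj' := fun a b h => by
        have h' : basicOpen a = basicOpen b := congrArg (fun U => ((OrderDual.ofDual U :
          CompactOpens (LatSpec L)) : Set (LatSpec L))) h
        exact le_antisymm (basicOpen_subset_iff.1 h'.superset) (basicOpen_subset_iff.1 h'.subset)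
      map_rel_iff' := basicOpen_subset_iff }
    fun U => by
      obtain ⟨a, ha⟩ := exists_eq_basicOpen (OrderDual.ofDual U).isOpen (OrderDual.ofDual U).isCompact
      exact ⟨a, congrArg OrderDual.toDual (CompactOpens.ext ha)⟩

/-- Homeomorphic spaces have isomorphic lattices of compact open sets. -/
def compactOpensCongr {X : Type u} {Y : Type v} [TopologicalSpace X] [TopologicalSpace Y]
    (h : X ≃ₜ Y) : CompactOpens X ≃o CompactOpens Y where
  toFun := CompactOpens.map h h.continuous h.isOpenMap
  invFun := CompactOpens.map h.symm h.symm.continuous h.symm.isOpenMap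
  left_inv U := CompactOpens.ext (h.symm_image_image U)
  right_inv U := CompactOpens.ext (h.image_symm_image U)
  map_rel_iff' := Set.image_subset_image_iff h.injective

/-- Bounded distributive lattices with homeomorphic spectra are isomorphic. -/
noncomputable def LatSpec.orderIsoOfHomeomorph {M : Type v} [DistribLattice M] [BoundedOrder M]
    (h : LatSpec L ≃ₜ LatSpec M) : L ≃o M :=
  (compactOpensIso.trans (compactOpensCongr h).dual).trans compactOpensIso.symm

end LatticeSpectrum

/-! ### The reticulation as the dual of the lattice of principal filters -/

section Reticulation

variable {A : Type u} [ResiduatedLattice A]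

/-- The class of `a` in the reticulation. -/
def Reticulation.mk (a : A) : Reticulation A := ⟨primesOver a, a, rfl⟩

theorem Reticulation.mk_surjective : Function.Surjective (mk : A → Reticulation A) := by
  rintro ⟨_, a, rfl⟩
  exact ⟨a, rfl⟩

theorem Reticulation.mk_mul (a b : A) : mk (a * b) = mk a ⊓ mk b :=
  Subtype.ext (primesOver_mul a b)

theorem Reticulation.mk_sup (a b : A) : mk (a ⊔ b) = mk a ⊔ mk b :=
  Subtype.ext (primesOver_sup a b)

theorem Reticulation.mk_bot : mk (⊥ : A) = ⊥ := Subtype.ext primesOver_bot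

theorem Reticulation.mk_mono {a b : A} (h : a ≤ b) : mk a ≤ mk b :=
  fun _ ha => Filt.mem_of_le ha h

/-- The prime filter of the reticulation associated with a prime filter of `A`. -/
def ResSpec.toLatSpec (P : ResSpec A) : LatSpec (Reticulation A) :=
  ⟨Order.IsPFilter.toPFilter (F := {U | P ∈ U.1}) <| by
    refine .of_def ⟨⊤, trivial⟩ ?_ fun h hP => h hP
    exact fun U hU V hV => ⟨U ⊓ V, ⟨hU, hV⟩, inf_le_left, inf_le_right⟩,
  ⟨{  IsLowerSet := fun U V h hU hV => hU (h hV)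
      Nonempty := ⟨⊥, id⟩
      Directed := fun U hU V hV => ⟨U ⊔ V, fun h => h.elim hU hV, le_sup_left, le_sup_right⟩ }⟩⟩

/-- The prime filter of `A` associated with a prime filter of the reticulation. -/
def ResSpec.ofLatSpec (Q : LatSpec (Reticulation A)) : ResSpec A :=
  ⟨{  carrier := {a | Reticulation.mk a ∈ Q.1}
      nonempty' := by
        obtain ⟨U, hU⟩ := Q.1.nonempty
        obtain ⟨a, rfl⟩ := Reticulation.mk_surjective U
        exact ⟨a, hU⟩
      mul_mem' := fun {x y} hx hy => by
        change Reticulation.mk (x * y) ∈ Q.1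
        rw [Reticulation.mk_mul]
        exact Order.PFilter.inf_mem hx hy
      mem_of_le' := fun hx h => Order.PFilter.mem_of_le (Reticulation.mk_mono h) hx },
    fun h => LatSpec.bot_notMem Q (Reticulation.mk_bot (A := A) ▸
      (h.ge (Filt.principal_le.1 (le_top : Filt.principal (⊥ : A) ≤ ⊤)))),
    fun x y h => by
      have h' : Reticulation.mk (x ⊔ y) ∈ Q.1 := h
      rw [Reticulation.mk_sup] at h'
      exact Q.sup_mem_iff.1 h'⟩

/-- The prime filters of `A` and those of its reticulation form homeomorphic spaces. -/
def reticulationHomeomorph (A : Type u) [ResiduatedLattice A] :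
    ResSpec A ≃ₜ LatSpec (Reticulation A) where
  toFun := ResSpec.toLatSpec
  invFun := ResSpec.ofLatSpec
  -- Membership of `a` in the resulting filter unfolds to membership of the given point in
  -- `primesOver a`, hence to membership of `a` in the original filter.
  left_inv _ := rfl
  right_inv Q := Subtype.ext <| SetLike.ext fun U => by
    obtain ⟨a, rfl⟩ := Reticulation.mk_surjective U
    rfl
  continuous_toFun := continuous_generateFrom_iff.2 <| by
    rintro _ ⟨U, rfl⟩
    obtain ⟨a, rfl⟩ := Reticulation.mk_surjective U
    exact TopologicalSpace.isOpen_generateFrom_of_mem ⟨a, rfl⟩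
  continuous_invFun := continuous_generateFrom_iff.2 <| by
    rintro _ ⟨a, rfl⟩
    exact TopologicalSpace.isOpen_generateFrom_of_mem ⟨Reticulation.mk a, rfl⟩

/-- The class of `x` in the lattice of principal filters. -/
def PFilt.mk (x : A) : PFilt A := ⟨Filt.principal x, x, rfl⟩

theorem PFilt.mk_surjective : Function.Surjective (mk : A → PFilt A) := by
  rintro ⟨_, a, rfl⟩
  exact ⟨a, rfl⟩

theorem PFilt.mk_le_mk {a b : A} : mk a ≤ mk b ↔ Filt.principal a ≤ Filt.principal b := Iff.rfl

theorem PFilt.mk_mul (a b : A) : mk (a * b) = mk a ⊔ mk b :=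
  Subtype.ext (Filt.principal_sup a b).symm

theorem PFilt.mk_sup (a b : A) : mk (a ⊔ b) = mk a ⊓ mk b :=
  Subtype.ext (Filt.principal_inf a b).symm

theorem PFilt.mk_bot : mk (⊥ : A) = ⊤ := Subtype.ext Filt.principal_bot

/-- The prime filter of `A` associated with a prime ideal of the lattice of principal filters. -/
def ResSpec.ofPrimeIdeal (J : Order.Ideal (PFilt A)) (hJ : J.IsPrime) : ResSpec A :=
  ⟨{  carrier := {a | PFilt.mk a ∈ J}
      nonempty' := by
        obtain ⟨U, hU⟩ := J.nonempty
        obtain ⟨a, rfl⟩ := PFilt.mk_surjective U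
        exact ⟨a, hU⟩
      mul_mem' := fun {x y} hx hy => by
        change PFilt.mk (x * y) ∈ J
        rw [PFilt.mk_mul]
        exact Order.Ideal.sup_mem hx hy
      mem_of_le' := fun {x y} hx h => J.lower (PFilt.mk_le_mk.2 (Filt.principal_le.2
        (Filt.mem_of_le (Filt.mem_principal_self x) h))) hx },
    fun h => Order.Ideal.top_notMem_iff_ne_top.2 hJ.toIsProper.ne_top (PFilt.mk_bot (A := A) ▸
      (h.ge (Filt.principal_le.1 (le_top : Filt.principal (⊥ : A) ≤ ⊤)))),
    fun x y h => by
      have h' : PFilt.mk (x ⊔ y) ∈ J := h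
      rw [PFilt.mk_sup] at h'
      exact hJ.mem_or_mem h'⟩

/-- The prime filter theorem for `A` comes from the prime ideal theorem in the distributive lattice
`PFilt A`: a prime ideal there that contains the class of `a` but not that of `b` pulls back to a
prime filter of `A`. -/
theorem primesOver_subset_iff {a b : A} : primesOver a ⊆ primesOver b ↔ b ∈ Filt.principal a := by
  refine ⟨fun h => ?_, fun h P ha => Filt.principal_le.2 ha h⟩
  by_contra hb
  obtain ⟨J, hJ, haJ, hbJ⟩ := DistribLattice.prime_ideal_of_disjoint_filter_ideal
    (F := .principal (PFilt.mk b)) (I := .principal (PFilt.mk a))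
    (Set.disjoint_left.2 fun x hx hx' => hb <| Filt.principal_le.1 <| PFilt.mk_le_mk.1 <|
      (Order.PFilter.mem_principal.1 hx).trans (Order.Ideal.mem_principal.1 hx'))
  have ha : ResSpec.ofPrimeIdeal J hJ ∈ primesOver a := Order.Ideal.principal_le_iff.1 haJ
  exact Set.disjoint_left.1 hbJ (Order.PFilter.mem_principal.2 le_rfl) (h ha)

/-- The reticulation of `A` is dually isomorphic to the lattice of the principal filters of `A`. -/
noncomputable def reticulationIso (A : Type u) [ResiduatedLattice A] :
    Reticulation A ≃o (PFilt A)ᵒᵈ where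
  -- The choice of representative is harmless: by `primesOver_subset_iff`, elements lie in the same
  -- prime filters exactly when they generate the same filter.
  toFun U := OrderDual.toDual (PFilt.mk U.2.choose)
  invFun F := Reticulation.mk (OrderDual.ofDual F).2.choose
  left_inv U := by
    refine Subtype.ext (Eq.trans ?_ U.2.choose_spec)
    have h := (PFilt.mk U.2.choose).2.choose_spec
    exact Set.Subset.antisymm
      (primesOver_subset_iff.2 (Filt.principal_le.1 (h.symm.le)))
      (primesOver_subset_iff.2 (Filt.principal_le.1 h.le))
  right_inv F := by
    refine Subtype.ext (Eq.trans ?_ (OrderDual.ofDual F).2.choose_spec)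
    have h := (Reticulation.mk (OrderDual.ofDual F).2.choose).2.choose_spec
    exact le_antisymm
      (Filt.principal_le.2 (primesOver_subset_iff.1 h.symm.subset))
      (Filt.principal_le.2 (primesOver_subset_iff.1 h.subset))
  map_rel_iff' {U V} := by
    refine Iff.trans ?_ (iff_of_eq (congrArg₂ (· ⊆ ·) U.2.choose_spec V.2.choose_spec))
    rw [primesOver_subset_iff, ← Filt.principal_le]
    rfl

/-- Every reticulation of `A` is dually isomorphic to the lattice of the principal filters. -/
theorem IsReticulation.nonempty_orderIso {L : Type v} [DistribLattice L] [BoundedOrder L]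
    (h : IsReticulation A L) : Nonempty (L ≃o (PFilt A)ᵒᵈ) :=
  h.map fun i => (LatSpec.orderIsoOfHomeomorph (i.symm.trans (reticulationHomeomorph A))).trans
    (reticulationIso A)

end Reticulation

/-! ### Complements in a residuated lattice -/

section Complements

variable {A : Type u} [ResiduatedLattice A]

/-- Since the unit is `⊤`, `x = x * (a ⊔ b)`, and the product distributes over joins. This replaces
lattice distributivity, which `A` need not satisfy. -/
theorem le_of_mul_le_of_sup_eq_top {a b x y : A} (h : a ⊔ b = ⊤) (ha : x * a ≤ y)
    (hb : x * b ≤ y) : x ≤ y := by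
  have := mul_sup_le ha hb
  rwa [h, ← ResiduatedLattice.one_eq_top, mul_one] at this

theorem isCompl_iff_mul_eq_bot {a b : A} : IsCompl a b ↔ a * b = ⊥ ∧ a ⊔ b = ⊤ := by
  refine ⟨fun h => ⟨?_, h.sup_eq_top⟩, fun ⟨hm, hs⟩ => .of_eq ?_ hs⟩
  · exact le_bot_iff.1 (h.inf_eq_bot ▸ le_inf (mul_le_l a b) (mul_le_r a b))
  · refine le_bot_iff.1 (le_of_mul_le_of_sup_eq_top hs ?_ ?_)
    · rw [← hm, mul_comm a b]
      exact mul_le_mul_r inf_le_right a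
    · exact hm ▸ mul_le_mul_r inf_le_left b

theorem _root_.IsCompl.le_of_mul_eq_bot {a b x : A} (h : IsCompl a b) (hx : x * b = ⊥) : x ≤ a :=
  le_of_mul_le_of_sup_eq_top h.sup_eq_top (mul_le_r x a) (hx.trans_le bot_le)

end Complements

/-! ### Complemented filters and B-normality of the filter lattice -/

namespace Filt

variable {A : Type u} [ResiduatedLattice A]

theorem mem_inf {F G : Filt A} {x : A} : x ∈ F ⊓ G ↔ x ∈ F ∧ x ∈ G := by
  simp only [← principal_le, le_inf_iff]

theorem mem_bot {x : A} : x ∈ (⊥ : Filt A) ↔ x = ⊤ := by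
  refine ⟨fun h => ?_, fun h => h ▸ top_mem ⊥⟩
  let F : Filt A :=
    { carrier := {⊤}
      nonempty' := ⟨⊤, rfl⟩
      mul_mem' := by
        rintro _ _ rfl rfl
        rw [← ResiduatedLattice.one_eq_top, mul_one]
        rfl
      mem_of_le' := by
        rintro _ y rfl h
        exact top_le_iff.1 h }
  exact (bot_le : ⊥ ≤ F) h

theorem mem_sup {F G : Filt A} {x : A} : x ∈ F ⊔ G ↔ ∃ f ∈ F, ∃ g ∈ G, f * g ≤ x := by
  constructor
  · intro h
    let H : Filt A :=
      { carrier := {x | ∃ f ∈ F, ∃ g ∈ G, f * g ≤ x}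
        nonempty' := ⟨⊤, ⊤, F.top_mem, ⊤, G.top_mem, le_top⟩
        mul_mem' := by
          rintro x y ⟨f, hf, g, hg, h⟩ ⟨f', hf', g', hg', h'⟩
          refine ⟨f * f', mul_mem hf hf', g * g', mul_mem hg hg', ?_⟩
          rw [mul_mul_mul_comm]
          exact mul_le_mul_both h h'
        mem_of_le' := fun ⟨f, hf, g, hg, h⟩ hxy => ⟨f, hf, g, hg, h.trans hxy⟩ }
    have hF : F ≤ H := fun f hf => ⟨f, hf, ⊤, G.top_mem, mul_le_l _ _⟩
    have hG : G ≤ H := fun g hg => ⟨⊤, F.top_mem, g, hg, mul_le_r _ _⟩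
    exact sup_le hF hG h
  · rintro ⟨f, hf, g, hg, h⟩
    have hf' : f ∈ F ⊔ G := (le_sup_left : F ≤ F ⊔ G) hf
    have hg' : g ∈ F ⊔ G := (le_sup_right : G ≤ F ⊔ G) hg
    exact mem_of_le (mul_mem hf' hg') h

theorem eq_top_iff_bot_mem {F : Filt A} : F = ⊤ ↔ ⊥ ∈ F := by
  rw [← principal_le, principal_bot, top_le_iff]

theorem sup_eq_top_iff {F G : Filt A} : F ⊔ G = ⊤ ↔ ∃ f ∈ F, ∃ g ∈ G, f * g = ⊥ := by
  simp only [eq_top_iff_bot_mem, mem_sup, le_bot_iff]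

/-- The lattice of filters is distributive. -/
instance : DistribLattice (Filt A) :=
  DistribLattice.ofInfSupLe fun F G H z hz => by
    obtain ⟨hF, hGH⟩ := mem_inf.1 hz
    obtain ⟨g, hg, h, hh, hgh⟩ := mem_sup.1 hGH
    -- Joining `z` to `g` and `h` moves both into `F`, while their product stays below `z ⊔ g * h ≤
    -- z`.
    refine mem_sup.2 ⟨z ⊔ g, ?_, z ⊔ h, ?_, (sup_mul_sup_le z g h).trans (sup_le le_rfl hgh)⟩
    · exact mem_inf.2 ⟨mem_of_le hF le_sup_left, mem_of_le hg le_sup_right⟩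
    · exact mem_inf.2 ⟨mem_of_le hF le_sup_left, mem_of_le hh le_sup_right⟩

theorem isCompl_principal {e e' : A} (h : IsCompl e e') :
    IsCompl (principal e) (principal e') := by
  obtain ⟨hm, hs⟩ := isCompl_iff_mul_eq_bot.1 h
  refine .of_eq ?_ ?_
  · rw [principal_inf, hs, principal_top]
  · rw [principal_sup, hm, principal_bot]

/-- No powers of `e` are needed: `x ⊔ e'` lies in two filters that meet in `⊥`, so it is `⊤`, and
multiplying by `e` kills the `e'` part. -/
theorem mem_principal_iff_of_isCompl {e e' x : A} (h : IsCompl e e') :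
    x ∈ principal e ↔ e ≤ x := by
  refine ⟨fun hx => ?_, mem_of_le (mem_principal_self e)⟩
  have hs : x ⊔ e' ∈ principal e ⊓ principal e' :=
    mem_inf.2 ⟨mem_of_le hx le_sup_left, mem_of_le (mem_principal_self e') le_sup_right⟩
  rw [(isCompl_principal h).inf_eq_bot, mem_bot] at hs
  exact le_of_mul_le_of_sup_eq_top hs (mul_le_r e x)
    ((isCompl_iff_mul_eq_bot.1 h).1.trans_le bot_le)

theorem principal_injOn_boolCenter : Set.InjOn (principal : A → Filt A) (boolCenter A) := by
  rintro e ⟨e', he⟩ f ⟨f', hf⟩ h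
  refine le_antisymm ((mem_principal_iff_of_isCompl he).1 ?_)
    ((mem_principal_iff_of_isCompl hf).1 ?_)
  · exact h ▸ mem_principal_self f
  · exact h ▸ mem_principal_self e

/-- The join being `⊤` supplies `f ∈ F` and `g ∈ G` with `f * g = ⊥`; the meet being `⊥` forces `x ⊔
y = ⊤` for all `x ∈ F`, `y ∈ G`. Hence `f` and `g` are complementary, and each is the least element
of its filter. -/
theorem exists_isCompl_of_isCompl {F G : Filt A} (h : IsCompl F G) :
    ∃ e e' : A, IsCompl e e' ∧ F = principal e ∧ G = principal e' := by
  obtain ⟨f, hf, g, hg, hfg⟩ := sup_eq_top_iff.1 h.sup_eq_top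
  have hs {x y : A} (hx : x ∈ F) (hy : y ∈ G) : x ⊔ y = ⊤ := by
    rw [← mem_bot, ← h.inf_eq_bot]
    exact mem_inf.2 ⟨mem_of_le hx le_sup_left, mem_of_le hy le_sup_right⟩
  refine ⟨f, g, isCompl_iff_mul_eq_bot.2 ⟨hfg, hs hf hg⟩, le_antisymm (fun x hx => ?_)
    (principal_le.2 hf), le_antisymm (fun x hx => ?_) (principal_le.2 hg)⟩
  · exact mem_of_le (mem_principal_self f)
      (le_of_mul_le_of_sup_eq_top (hs hx hg) (mul_le_r f x) (hfg.trans_le bot_le))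
  · refine mem_of_le (mem_principal_self g)
      (le_of_mul_le_of_sup_eq_top (hs hf hx) ?_ (mul_le_r g x))
    rw [mul_comm, hfg]
    exact bot_le

theorem boolCenter_eq_image : boolCenter (Filt A) = principal '' boolCenter A := by
  refine Set.Subset.antisymm ?_ ?_
  · rintro F ⟨G, h⟩
    obtain ⟨e, e', he, rfl, -⟩ := exists_isCompl_of_isCompl h
    exact ⟨e, ⟨e', he⟩, rfl⟩
  · rintro _ ⟨e, ⟨e', he⟩, rfl⟩
    exact ⟨_, isCompl_principal he⟩

/-- The filters `F` and `G` contain complementary elements of `A`. -/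
def ContainsCompl (F G : Filt A) : Prop := ∃ e e' : A, IsCompl e e' ∧ e ∈ F ∧ e' ∈ G

theorem bNormal_iff : BNormal (Filt A) ↔ ∀ F G : Filt A, F ⊔ G = ⊤ → ContainsCompl F G := by
  refine bNormal_iff_exists_isCompl.trans (forall₃_congr fun F G _ => ⟨?_, ?_⟩)
  · rintro ⟨E, E', hE, hF, hG⟩
    obtain ⟨e, e', he, rfl, rfl⟩ := exists_isCompl_of_isCompl hE
    exact ⟨e, e', he, principal_le.1 hF, principal_le.1 hG⟩
  · rintro ⟨e, e', he, hF, hG⟩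
    exact ⟨_, _, isCompl_principal he, principal_le.2 hF, principal_le.2 hG⟩

end Filt

/-! ### B-normality of the lattice of principal filters -/

section PrincipalFilters

variable {A : Type u} [ResiduatedLattice A]

theorem PFilt.isCompl_iff {F G : PFilt A} : IsCompl F G ↔ IsCompl F.1 G.1 := by
  simp only [_root_.isCompl_iff, disjoint_iff, codisjoint_iff]
  exact and_congr Subtype.ext_iff (Subtype.ext_iff.trans (iff_of_eq (congrArg _ rfl)))

theorem PFilt.bNormal_iff : BNormal (PFilt A) ↔
    ∀ x y : A, x * y = ⊥ → (Filt.principal x).ContainsCompl (Filt.principal y) := by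
  refine bNormal_iff_exists_isCompl.trans ⟨fun h x y hxy => ?_, ?_⟩
  · obtain ⟨E, E', hE, hx, hy⟩ := h (mk x) (mk y) (by rw [← mk_mul, hxy, mk_bot])
    obtain ⟨e, e', he, hF, hG⟩ := Filt.exists_isCompl_of_isCompl (isCompl_iff.1 hE)
    exact ⟨e, e', he, Filt.principal_le.1 (hF ▸ hx), Filt.principal_le.1 (hG ▸ hy)⟩
  · rintro h ⟨F, hF⟩ ⟨G, hG⟩ hFG
    -- For generators of `F` and `G` only some power of the product need vanish, so members with
    -- product `⊥` are taken instead.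
    obtain ⟨x, hx, y, hy, hxy⟩ := Filt.sup_eq_top_iff.1 (congrArg Subtype.val hFG : F ⊔ G = ⊤)
    obtain ⟨e, e', he, hex, hey⟩ := h x y hxy
    exact ⟨mk e, mk e', isCompl_iff.2 (Filt.isCompl_principal he),
      Filt.principal_le.2 (Filt.principal_le.2 hx hex),
      Filt.principal_le.2 (Filt.principal_le.2 hy hey)⟩

end PrincipalFilters

/-! ### BLP and complementary elements in comaximal filters -/

section BooleanLifting

variable {A : Type u} [ResiduatedLattice A]

theorem Filt.con_top_iff {F : Filt A} {x : A} : F.con.r x ⊤ ↔ x ∈ F := by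
  refine biresid_mem_iff.trans ⟨?_, fun h => ⟨⟨x, h, le_top⟩, x, h, mul_le_l x ⊤⟩⟩
  rintro ⟨-, p, hp, h⟩
  rw [← ResiduatedLattice.one_eq_top, mul_one] at h
  exact mem_of_le hp h

theorem Filt.con_bot_iff {F : Filt A} {x : A} : F.con.r x ⊥ ↔ ∃ p ∈ F, p * x = ⊥ := by
  refine biresid_mem_iff.trans ⟨?_, fun ⟨p, hp, h⟩ => ⟨⟨p, hp, h.le⟩, p, hp, ?_⟩⟩
  · rintro ⟨⟨p, hp, h⟩, -⟩
    exact ⟨p, hp, le_bot_iff.1 h⟩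
  · exact (mul_le_r p ⊥).trans bot_le

theorem Filt.isCompl_proj_iff {F : Filt A} {x y : A} :
    IsCompl (F.con.proj x) (F.con.proj y) ↔ (∃ p ∈ F, p * (x ⊓ y) = ⊥) ∧ x ⊔ y ∈ F := by
  refine (LatQuot.isCompl_mk_iff F.con.toLatticeCon).trans ?_
  exact and_congr con_bot_iff con_top_iff

/-- The preimage of a filter of `A/θ` in `A`. -/
def ResCon.comapFilt (θ : ResCon A) (G : Filt θ.Quot) : Filt A where
  carrier := {x | θ.proj x ∈ G}
  nonempty' := ⟨⊤, G.top_mem⟩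
  mul_mem' := Filt.mul_mem
  mem_of_le' hx h := Filt.mem_of_le hx (θ.proj_mono h)

theorem ResCon.proj_mem_principal (θ : ResCon A) {x y : A} (h : y ∈ Filt.principal x) :
    θ.proj y ∈ Filt.principal (θ.proj x) :=
  (Filt.principal_le.2 (Filt.mem_principal_self (θ.proj x)) :
    Filt.principal x ≤ θ.comapFilt (Filt.principal (θ.proj x))) h

/-- With `f * g = ⊥`, the element `f ⊔ g` lies in `F ⊓ G` and annihilates `f ⊓ g`, so `f` and `g`
become complementary modulo `F ⊓ G`. A complemented lift `e` of `f` lies in `F`, and its complement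
lies in `G`. -/
theorem HasBLP.containsCompl (h : HasBLP A) {F G : Filt A} (hFG : F ⊔ G = ⊤) :
    F.ContainsCompl G := by
  obtain ⟨f, hf, g, hg, hfg⟩ := Filt.sup_eq_top_iff.1 hFG
  have hs : f ⊔ g ∈ F ⊓ G :=
    Filt.mem_inf.2 ⟨Filt.mem_of_le hf le_sup_left, Filt.mem_of_le hg le_sup_right⟩
  have hc : IsCompl ((F ⊓ G).con.proj f) ((F ⊓ G).con.proj g) := by
    refine Filt.isCompl_proj_iff.2 ⟨⟨f ⊔ g, hs, le_bot_iff.1 ?_⟩, hs⟩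
    rw [mul_comm]
    refine mul_sup_le ?_ ((mul_le_mul_r inf_le_left g).trans hfg.le)
    rw [mul_comm]
    exact (mul_le_mul_both le_rfl inf_le_right).trans hfg.le
  obtain ⟨e, ⟨e', he⟩, hef⟩ := h (F ⊓ G) ⟨_, hc⟩
  obtain ⟨⟨p, hp, hpe⟩, q, hq, hqf⟩ := Filt.biresid_mem_iff.1 ((F ⊓ G).con.proj_eq_iff.1 hef)
  -- Here `q * f ≤ e`, and `p * g ≤ e'` because `p * g * e ≤ f * g = ⊥`.
  refine ⟨e, e', he, Filt.mem_of_le (Filt.mul_mem (Filt.mem_inf.1 hq).1 hf) hqf,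
    Filt.mem_of_le (Filt.mul_mem (Filt.mem_inf.1 hp).2 hg) (he.symm.le_of_mul_eq_bot ?_)⟩
  rw [mul_right_comm, ← le_bot_iff, ← hfg]
  exact mul_le_mul_r hpe g

/-- If `a` and `b` are complementary modulo `F`, some `p ∈ F` gives `p * a * b = ⊥`, and `p` becomes
the unit in the quotient. There `e` and `e'` lie in the filters generated by the classes of `a` and
`b`, which are mere up-sets. So `a ≤ e` and `b ≤ e'`, and `e * e' = ⊥` gives `e ≤ a`. -/
theorem hasBLP_of_containsCompl
    (h : ∀ x y : A, x * y = ⊥ → (Filt.principal x).ContainsCompl (Filt.principal y)) :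
    HasBLP A := by
  intro F q ⟨r, hqr⟩
  induction q using ResCon.ind with | _ a
  induction r using ResCon.ind with | _ b
  obtain ⟨⟨p, hp, hpab⟩, -⟩ := Filt.isCompl_proj_iff.1 hqr
  have hxy : p * a * b = ⊥ := by
    rw [mul_assoc, ← le_bot_iff, ← hpab]
    exact mul_le_mul_both le_rfl (le_inf (mul_le_l a b) (mul_le_r a b))
  obtain ⟨e, e', he, hea, heb⟩ := h _ _ hxy
  have hpa : F.con.proj (p * a) = F.con.proj a := by
    rw [ResCon.proj_mul, F.con.proj_eq_iff.2 (Filt.con_top_iff.2 hp)]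
    change (⊤ : F.con.Quot) * _ = _
    rw [← ResiduatedLattice.one_eq_top, one_mul]
  have h₁ := F.con.proj_mem_principal hea
  have h₂ := F.con.proj_mem_principal heb
  rw [hpa, Filt.mem_principal_iff_of_isCompl hqr] at h₁
  rw [Filt.mem_principal_iff_of_isCompl hqr.symm] at h₂
  refine ⟨e, ⟨e', he⟩, le_antisymm (hqr.le_of_mul_eq_bot (le_bot_iff.1 ?_)) h₁⟩
  refine (mul_le_mul_both le_rfl h₂).trans ?_
  rw [← ResCon.proj_mul, (isCompl_iff_mul_eq_bot.1 he).1]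
  rfl

theorem hasBLP_iff_bNormal_filt : HasBLP A ↔ BNormal (Filt A) := by
  rw [Filt.bNormal_iff]
  exact ⟨fun h F G => h.containsCompl, fun h => hasBLP_of_containsCompl fun x y hxy =>
    h _ _ (by rw [Filt.principal_sup, hxy, Filt.principal_bot])⟩

theorem hasBLP_iff_bNormal_pFilt : HasBLP A ↔ BNormal (PFilt A) := by
  rw [PFilt.bNormal_iff]
  exact ⟨fun h x y hxy => h.containsCompl (by rw [Filt.principal_sup, hxy, Filt.principal_bot]),
    hasBLP_of_containsCompl⟩

end BooleanLifting

/-! ### Congruences as filters, and CBLP -/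

section Congruences

variable {A : Type u} [ResiduatedLattice A]

/-- The filter `{x | x ∼ ⊤}` of a congruence. -/
def ResCon.filt (θ : ResCon A) : Filt A where
  carrier := {x | θ.proj x = ⊤}
  nonempty' := ⟨⊤, rfl⟩
  mul_mem' {x y} hx hy := by
    change θ.proj (x * y) = ⊤
    rw [ResCon.proj_mul, hx, hy, ← ResiduatedLattice.one_eq_top, mul_one]
  mem_of_le' hx h := top_le_iff.1 (hx.ge.trans (θ.proj_mono h))

theorem ResCon.mem_filt {θ : ResCon A} {x : A} : x ∈ θ.filt ↔ θ.proj x = ⊤ := Iff.rfl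

theorem ResCon.con_filt (θ : ResCon A) : θ.filt.con = θ := by
  -- By residuation an implication is `⊤` in the quotient exactly when the inequality holds there,
  -- so the filter determines the congruence.
  have himp {x y : A} : x ⇨ y ∈ θ.filt ↔ θ.proj x ≤ θ.proj y := by
    rw [mem_filt, proj_himp, ← top_le_iff, resid, ← ResiduatedLattice.one_eq_top, one_mul]
  refine ResCon.ext fun x y => ?_
  rw [← proj_eq_iff θ, le_antisymm_iff, ← himp, ← himp]
  exact Filt.inf_mem_iff

theorem Filt.filt_con (F : Filt A) : F.con.filt = F :=
  SetLike.ext fun _ => F.con.proj_eq_iff.trans con_top_iff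

theorem ResCon.filt_le_filt {θ φ : ResCon A} : θ.filt ≤ φ.filt ↔ θ ≤ φ := by
  refine ⟨fun h x y hxy => ?_, fun h x hx => φ.proj_eq_iff.2 (h (θ.proj_eq_iff.1 hx))⟩
  rw [← φ.con_filt]
  rw [← θ.con_filt] at hxy
  exact h hxy

/-- Congruences correspond to filters. -/
def resConIso (A : Type u) [ResiduatedLattice A] : Filt A ≃o ResCon A where
  toFun := Filt.con
  invFun := ResCon.filt
  left_inv := Filt.filt_con
  right_inv := ResCon.con_filt
  map_rel_iff' {F G} := by
    change F.con ≤ G.con ↔ F ≤ G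
    rw [← ResCon.filt_le_filt, F.filt_con, G.filt_con]

theorem ResCon.con_principal_le {φ : ResCon A} {e : A} :
    (Filt.principal e).con ≤ φ ↔ φ.proj e = ⊤ := by
  rw [← filt_le_filt, Filt.filt_con, Filt.principal_le, mem_filt]

theorem ResCon.boolCenter_eq_image :
    boolCenter (ResCon A) = (fun e => (Filt.principal e).con) '' boolCenter A := by
  have h : boolCenter (ResCon A) = resConIso A '' boolCenter (Filt A) := by
    refine Set.Subset.antisymm ?_ ?_
    · rintro θ ⟨φ, h⟩
      exact ⟨(resConIso A).symm θ, ⟨_, (resConIso A).symm.isCompl h⟩,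
        (resConIso A).apply_symm_apply θ⟩
    · rintro _ ⟨F, ⟨G, h⟩, rfl⟩
      exact ⟨_, (resConIso A).isCompl h⟩
  rw [h, Filt.boolCenter_eq_image, Set.image_image]
  rfl

/-- The preimage of a congruence of `A/θ` in `A`. -/
def ResCon.comap (θ : ResCon A) (ψ : ResCon θ.Quot) : ResCon A where
  r x y := ψ.r (θ.proj x) (θ.proj y)
  iseqv := ⟨fun _ => ψ.refl _, ψ.symm, ψ.trans⟩
  inf := ψ.inf
  sup := ψ.sup
  mul := ψ.mul
  himp := ψ.himp

/-- An adjunction between pushing congruences forward and pulling them back, which lets images be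
computed by their upper bounds. -/
theorem ResCon.toQuotCon_le {θ α : ResCon A} {ψ : ResCon θ.Quot} :
    θ.toQuotCon α ≤ ψ ↔ α ≤ θ.comap ψ := by
  constructor
  · exact fun h x y hxy => h ⟨x, y, rfl, rfl, (le_sup_left : α ≤ α ⊔ θ) hxy⟩
  · rintro h _ _ ⟨x, y, rfl, rfl, hxy⟩
    have hθ : θ ≤ θ.comap ψ := fun x y hxy => by
      change ψ.r (θ.proj x) (θ.proj y)
      rw [θ.proj_eq_iff.2 hxy]
    exact sup_le h hθ hxy

theorem ResCon.toQuotCon_con_principal (θ : ResCon A) (e : A) :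
    θ.toQuotCon (Filt.principal e).con = (Filt.principal (θ.proj e)).con := by
  refine eq_of_forall_ge_iff fun ψ => ?_
  rw [toQuotCon_le, con_principal_le, con_principal_le]
  exact (θ.comap ψ).proj_eq_iff.trans ψ.proj_eq_iff.symm

/-- Complemented congruences come from complemented elements, and `toQuotCon` acts on the latter as
`proj`. Injectivity on complemented elements turns equal congruences back into equal elements. -/
theorem ResCon.hasCBLP_iff (θ : ResCon A) :
    θ.HasCBLP ↔ Set.SurjOn θ.proj (boolCenter A) (boolCenter θ.Quot) := by
  unfold ResCon.HasCBLP
  rw [boolCenter_eq_image, boolCenter_eq_image]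
  constructor
  · intro h q hq
    obtain ⟨_, ⟨e, ⟨e', he⟩, rfl⟩, h'⟩ := h ⟨q, hq, rfl⟩
    refine ⟨e, ⟨e', he⟩, ?_⟩
    refine Filt.principal_injOn_boolCenter ⟨_, LatQuot.isCompl_mk θ.toLatticeCon he⟩ hq ?_
    exact (resConIso _).injective ((θ.toQuotCon_con_principal e).symm.trans h')
  · rintro h _ ⟨q, hq, rfl⟩
    obtain ⟨e, he, rfl⟩ := h hq
    exact ⟨_, ⟨e, he, rfl⟩, θ.toQuotCon_con_principal e⟩

theorem hasCBLP_iff_hasBLP : HasCBLP A ↔ HasBLP A :=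
  (forall_congr' ResCon.hasCBLP_iff).trans (resConIso A).surjective.forall

end Congruences

end ResLat

open ResLat in
theorem mainTheorem6 {A : Type u} [ResiduatedLattice A] :
    IsReticulation A (Reticulation A) ∧
    ∀ (L : Type v) [DistribLattice L] [BoundedOrder L], IsReticulation A L →
      List.TFAE
        [HasCBLP A,
         HasBLP A,
         BNormal (ResCon A),
         BNormal (Filt A),
         BNormal (PFilt A),
         BConormal L,
         HasFiltBLP L,
         HasIdBLP (PFilt A)] := by
  refine ⟨⟨reticulationHomeomorph A⟩, fun L _ _ hL => ?_⟩
  obtain ⟨i⟩ := hL.nonempty_orderIso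
  tfae_have 1 ↔ 2 := hasCBLP_iff_hasBLP
  tfae_have 3 ↔ 4 := (bNormal_congr (resConIso A)).symm
  tfae_have 2 ↔ 4 := hasBLP_iff_bNormal_filt
  tfae_have 2 ↔ 5 := hasBLP_iff_bNormal_pFilt
  -- B-conormality of `L` is B-normality of `Lᵒᵈ`, and dualizing `i` identifies `Lᵒᵈ` with `PFilt
  -- A`.
  tfae_have 6 ↔ 5 := bNormal_congr (i.dual.trans (OrderIso.dualDual (PFilt A)).symm)
  tfae_have 7 ↔ 6 := hasFiltBLP_iff_bConormal
  tfae_have 8 ↔ 5 := hasIdBLP_iff_bNormal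
  tfae_finish
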